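/- All polynomials are real and in the $n$ variables $x=(x_1,\dots,x_n)$; $\|\cdot\|$ is the Euclidean norm. For a homogeneous polynomial $f$ put $\|f\|_2=\sup_{\|x\|=1}|f(x)|$. For a form $f$ of even degree $D$ put $$\Lambda(f)=\inf\Bigl\{\sup_{\|z\|=1}z^{T}Mz \;:\; M\in\mathbb R^{[n]^{D/2}\times[n]^{D/2}}\text{ symmetric},\ (x^{\otimes D/2})^{T}M\,x^{\otimes D/2}=f(x)\ \text{for all }x\in\mathbb R^n\Bigr\}.$$ A degree-$(d_1,d_2)$ folded polynomial is an expression $h=\sum_{|\beta|=d_1}\overline{h}_\beta(x)\,x^\beta$ whose coefficients $\overline h_\beta$ (the folds of $h$) are forms of degree $d_2$ in $x$. Its unfolding is the form of degree $d_1+d_2$ obtained by multiplying the folds with the monomials in $\mathbb R[x]$. For $y\in\mathbb R^n$, $h(y)=\sum_{|\beta|=d_1}y^\beta\,\overline h_\beta(x)$, a form of degree $d_2$ in $x$. Let $$\Gamma=\sup\Bigl\{\frac{\Lambda(p)}{\|p\|_2} \;:\; p\in\mathrm{span}_{\mathbb R}\{\overline h_\beta : |\beta|=d_1\},\ p\neq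 0\Bigr\}$$ (with $\Gamma=0$ if $h=0$). **Theorem.** There is an absolute constant $A>0$ such that the following holds. Let $d_1,d_2\ge 0$ be integers with $d_2$ even, let $d=d_1+d_2$, let $h$ be a degree-$(d_1,d_2)$ folded polynomial with unfolding $f$, let $K$ be a real number, and suppose that $$\sup_{\|y\|=1}\|h(y)\|_2\le K\,\|f\|_2 .$$ (The reverse inequality $\|f\|_2\le\sup_{\|y\|=1}\|h(y)\|_2$ always holds.) Then for every integer $q$ with $1\le q\le n$ that is divisible by $2d$, $$\Lambda\bigl(f^{\,q/d}\bigr)^{d/q}\;\le\; A^{d}\,K\cdot\Gamma\cdot\Bigl(\frac nq\Bigr)^{d_1/2}\cdot\|f\|_2 .$$ In particular, if $\sup_{\|y\|=1}\|h(y)\|_2=\Theta_d(\|f\|_2)$, then $\Lambda(f^{q/d})^{d/q}\le O_d\bigl(\Gamma\,(n/q)^{d_1/2}\bigr)\cdot\|f\|_2$. -/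

import Mathlib

open scoped Matrix

noncomputable section

/-- `‖f‖₂`: the supremum of `|f(x)|` over the Euclidean unit sphere of `ℝⁿ`. -/
def sphereNorm {n : ℕ} (f : MvPolynomial (Fin n) ℝ) : ℝ :=
  sSup {t : ℝ | ∃ x : EuclideanSpace ℝ (Fin n),
    ‖x‖ = 1 ∧ t = |MvPolynomial.eval (fun i => x i) f|}

/-- The tensor power `x^{⊗ m}`, a vector indexed by the tuples `I ∈ [n]^m`. -/
def tensorPow {n : ℕ} (m : ℕ) (x : Fin n → ℝ) : (Fin m → Fin n) → ℝ :=
  fun I => ∏ j, x (I j)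

/-- `M` is a symmetric matrix, indexed by `[n]^m`, that represents the form `f` of degree `2m`:
`f(x) = (x^{⊗ m})ᵀ M x^{⊗ m}` for all real `x`. -/
def IsMatrixRep {n : ℕ} (m : ℕ) (M : Matrix (Fin m → Fin n) (Fin m → Fin n) ℝ)
    (f : MvPolynomial (Fin n) ℝ) : Prop :=
  M.IsSymm ∧
    ∀ x : Fin n → ℝ, tensorPow m x ⬝ᵥ (M *ᵥ tensorPow m x) = MvPolynomial.eval x f

/-- `sup_{‖z‖ = 1} zᵀ M z` for the Euclidean norm. -/
def maxQuadForm {ι : Type*} [Fintype ι] (M : Matrix ι ι ℝ) : ℝ :=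
  sSup {t : ℝ | ∃ z : EuclideanSpace ℝ ι,
    ‖z‖ = 1 ∧ t = (fun i => z i) ⬝ᵥ (M *ᵥ fun i => z i)}

/-- `Λ(f)` for a form `f` of even degree `D`: the infimum of `sup_{‖z‖ = 1} zᵀ M z` over all
symmetric matrix representations `M` of `f`. -/
def sosLambda {n : ℕ} (D : ℕ) (f : MvPolynomial (Fin n) ℝ) : ℝ :=
  sInf {t : ℝ | ∃ M : Matrix (Fin (D / 2) → Fin n) (Fin (D / 2) → Fin n) ℝ,
    IsMatrixRep (D / 2) M f ∧ t = maxQuadForm M}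

/-- Polynomials in `x₁, …, xₙ` whose coefficients are themselves real polynomials in
`x₁, …, xₙ`. -/
abbrev PolyCoeffPoly (n : ℕ) : Type := MvPolynomial (Fin n) (MvPolynomial (Fin n) ℝ)

/-- `h` is a degree-`(d₁, d₂)` folded polynomial: its monomials have degree `d₁`, and its
coefficients (the folds of `h`) are forms of degree `d₂`. -/
structure IsFolded {n : ℕ} (d₁ d₂ : ℕ) (h : PolyCoeffPoly n) : Prop where
  monomials : h.IsHomogeneous d₁
  folds : ∀ β : Fin n →₀ ℕ, (MvPolynomial.coeff β h).IsHomogeneous d₂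

/-- The unfolding of `h`: multiply the folds with the monomials in `ℝ[x]`. -/
def unfolding {n : ℕ} (h : PolyCoeffPoly n) : MvPolynomial (Fin n) ℝ :=
  MvPolynomial.eval MvPolynomial.X h

/-- The evaluation `h(y)`: real values are substituted in the monomials only, the folds are
treated as coefficients, and the result is a polynomial in `x`. -/
def foldedEval {n : ℕ} (y : Fin n → ℝ) (h : PolyCoeffPoly n) : MvPolynomial (Fin n) ℝ :=
  MvPolynomial.eval (fun i => MvPolynomial.C (y i)) h

/-- `sup_{‖y‖ = 1} ‖h(y)‖₂`. -/
def foldedSup {n : ℕ} (h : PolyCoeffPoly n) : ℝ :=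
  sSup {t : ℝ | ∃ y : EuclideanSpace ℝ (Fin n),
    ‖y‖ = 1 ∧ t = sphereNorm (foldedEval (fun i => y i) h)}

/-- The linear span of the folds of a degree-`(d₁, d₂)` folded polynomial `h`. -/
def foldSpan {n : ℕ} (d₁ : ℕ) (h : PolyCoeffPoly n) : Submodule ℝ (MvPolynomial (Fin n) ℝ) :=
  Submodule.span ℝ ((fun β => MvPolynomial.coeff β h) '' {β : Fin n →₀ ℕ | β.degree = d₁})

/-- `Γ`: the worst ratio `Λ(p) / ‖p‖₂` over the nonzero `p` in the span of the folds of `h`. -/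
def foldGamma {n : ℕ} (d₁ d₂ : ℕ) (h : PolyCoeffPoly n) : ℝ :=
  sSup {t : ℝ | ∃ p ∈ foldSpan d₁ h, p ≠ 0 ∧ t = sosLambda d₂ p / sphereNorm p}

end

/-! Write `q = 2dr` and `m = d₁r`, and expand the `r`-th power of the unfolding as `f^r = ∑_α x^α
G_α`, where the `G_α` are the folds of `h^r`, `|α| = m`. Cauchy–Schwarz, as a sum-of-squares
identity, bounds `f^(2r)` by `N ∑_α x^(2α) G_α²`, with `N` the number of exponents. If `G_α²` is at
most `Q · multinomial(α)` times a power of `‖x‖²` in the sum-of-squares order, the multinomial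
theorem collapses the sum to `N Q ‖x‖^(2dr)` (`sub_sq_sum_mem_sosCone`). Since `N` is at most `C^q
(n/q)^m`, its `2r`-th root yields the factor `(n/q)^(d₁/2)`.

The folds `G_α` need not lie in the span of the folds of `h`, so `Γ` says nothing about them
directly. But each `h(y)` does lie in that span, hence is bounded in the sum-of-squares order by `Γ
‖h(y)‖₂`, and so is its power `h(y)^r` by the `r`-th power. A mixed finite difference of `y ↦
h(y)^r` isolates `G_α` (`sum_diffWeight_smul_eval`). On the grid `y_i = s_i / √α_i`, `0 ≤ s_i ≤
α_i`, one has `‖y‖² ≤ m`, and dividing by the scale of the difference gives exactly a bound of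
multinomial size (`inv_sq_diffScale_mul_pow_le`, `IsFolded.coeff_pow_sosBounded`).

`Λ` is the least constant in such a certificate up to an arbitrarily small loss: `sosLambda_le` and
`sub_mem_sosCone_of_sosLambda_lt`. -/

/-- The cone of sums of squares of forms of degree `D`. -/
noncomputable def sosCone (n D : ℕ) : AddSubmonoid (MvPolynomial (Fin n) ℝ) :=
  AddSubmonoid.closure {p | ∃ s : MvPolynomial (Fin n) ℝ, s.IsHomogeneous D ∧ p = s ^ 2}

/-- The form `x₁² + ⋯ + xₙ²`. -/
noncomputable def sqNorm (n : ℕ) : MvPolynomial (Fin n) ℝ := ∑ i, MvPolynomial.X i ^ 2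

/-- `p` is a form of degree `2 D` such that `c ‖x‖ ^ (2 D) - p` and `c ‖x‖ ^ (2 D) + p` are sums of
squares. -/
structure SosBounded {n : ℕ} (D : ℕ) (c : ℝ) (p : MvPolynomial (Fin n) ℝ) : Prop where
  homogeneous : p.IsHomogeneous (2 * D)
  upper : MvPolynomial.C c * sqNorm n ^ D - p ∈ sosCone n D
  lower : MvPolynomial.C c * sqNorm n ^ D + p ∈ sosCone n D

/-! ### Calculus of sum-of-squares bounds, and Cauchy–Schwarz in it. -/

section SosCone

open MvPolynomial

variable {n : ℕ}

theorem sq_mem_sosCone {D : ℕ} {s : MvPolynomial (Fin n) ℝ} (hs : s.IsHomogeneous D) :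
    s ^ 2 ∈ sosCone n D :=
  AddSubmonoid.subset_closure ⟨s, hs, rfl⟩

theorem C_mul_mem_sosCone {D : ℕ} {p : MvPolynomial (Fin n) ℝ} (hp : p ∈ sosCone n D) {a : ℝ}
    (ha : 0 ≤ a) : C a * p ∈ sosCone n D := by
  induction hp using AddSubmonoid.closure_induction with
  | mem x hx =>
    obtain ⟨s, hs, rfl⟩ := hx
    have : C a * s ^ 2 = (C (Real.sqrt a) * s) ^ 2 := by
      rw [mul_pow, ← C_pow, Real.sq_sqrt ha]
    rw [this]
    exact sq_mem_sosCone (hs.C_mul _)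
  | zero => simp
  | add x y _ _ hx hy => rw [mul_add]; exact add_mem hx hy

theorem mul_mem_sosCone {D E : ℕ} {p q : MvPolynomial (Fin n) ℝ} (hp : p ∈ sosCone n D)
    (hq : q ∈ sosCone n E) : p * q ∈ sosCone n (D + E) := by
  induction hp using AddSubmonoid.closure_induction with
  | mem x hx =>
    obtain ⟨s, hs, rfl⟩ := hx
    induction hq using AddSubmonoid.closure_induction with
    | mem y hy =>
      obtain ⟨t, ht, rfl⟩ := hy
      rw [← mul_pow]
      exact sq_mem_sosCone (hs.mul ht)
    | zero => simp
    | add x y _ _ hx hy => rw [mul_add]; exact add_mem hx hy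
  | zero => simp
  | add x y _ _ hx hy => rw [add_mul]; exact add_mem hx hy

theorem one_mem_sosCone : (1 : MvPolynomial (Fin n) ℝ) ∈ sosCone n 0 := by
  simpa using sq_mem_sosCone (isHomogeneous_one (Fin n) ℝ)

theorem sqNorm_mem_sosCone : sqNorm n ∈ sosCone n 1 :=
  sum_mem fun i _ => sq_mem_sosCone (isHomogeneous_X ℝ i)

theorem sqNorm_pow_mem_sosCone (D : ℕ) : sqNorm n ^ D ∈ sosCone n D := by
  induction D with
  | zero => simpa using one_mem_sosCone
  | succ D ih => rw [pow_succ]; exact mul_mem_sosCone ih sqNorm_mem_sosCone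

theorem eval_sqNorm (x : Fin n → ℝ) : eval x (sqNorm n) = ∑ i, x i ^ 2 := by
  simp [sqNorm]

namespace SosBounded

variable {D E : ℕ} {c c' : ℝ} {p q : MvPolynomial (Fin n) ℝ}

theorem zero (hc : 0 ≤ c) : SosBounded D c (0 : MvPolynomial (Fin n) ℝ) where
  homogeneous := isHomogeneous_zero _ _ _
  upper := by simpa using C_mul_mem_sosCone (sqNorm_pow_mem_sosCone D) hc
  lower := by simpa using C_mul_mem_sosCone (sqNorm_pow_mem_sosCone D) hc

theorem mono (hp : SosBounded D c p) (hc : c ≤ c') : SosBounded D c' p where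
  homogeneous := hp.homogeneous
  upper := by
    have := add_mem hp.upper (C_mul_mem_sosCone (sqNorm_pow_mem_sosCone D) (sub_nonneg.2 hc))
    convert this using 1
    rw [C_sub]; ring
  lower := by
    have := add_mem hp.lower (C_mul_mem_sosCone (sqNorm_pow_mem_sosCone D) (sub_nonneg.2 hc))
    convert this using 1
    rw [C_sub]; ring

theorem neg (hp : SosBounded D c p) : SosBounded D c (-p) where
  homogeneous := hp.homogeneous.neg
  upper := by simpa using hp.lower
  lower := by simpa [sub_eq_add_neg] using hp.upper

theorem add (hp : SosBounded D c p) (hq : SosBounded D c' q) : SosBounded D (c + c') (p + q) where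
  homogeneous := hp.homogeneous.add hq.homogeneous
  upper := by
    convert add_mem hp.upper hq.upper using 1
    rw [C_add]; ring
  lower := by
    convert add_mem hp.lower hq.lower using 1
    rw [C_add]; ring

theorem C_mul (hp : SosBounded D c p) (a : ℝ) : SosBounded D (|a| * c) (C a * p) := by
  have key : ∀ {a : ℝ} {p : MvPolynomial (Fin n) ℝ}, 0 ≤ a → SosBounded D c p →
      SosBounded D (a * c) (C a * p) := fun {a p} ha hp =>
    { homogeneous := hp.homogeneous.C_mul a
      upper := by
        convert C_mul_mem_sosCone hp.upper ha using 1
        rw [C.map_mul]; ring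
      lower := by
        convert C_mul_mem_sosCone hp.lower ha using 1
        rw [C.map_mul]; ring }
  rcases le_total 0 a with ha | ha
  · rw [abs_of_nonneg ha]; exact key ha hp
  · rw [abs_of_nonpos ha]
    simpa using key (neg_nonneg.2 ha) hp.neg

theorem sum {ι : Type*} (s : Finset ι) (c : ι → ℝ) (p : ι → MvPolynomial (Fin n) ℝ)
    (h : ∀ i ∈ s, SosBounded D (c i) (p i)) : SosBounded D (∑ i ∈ s, c i) (∑ i ∈ s, p i) := by
  classical
  induction s using Finset.induction_on with
  | empty => simpa using zero le_rfl
  | insert i s hi ih =>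
    rw [Finset.sum_insert hi, Finset.sum_insert hi]
    exact (h i (Finset.mem_insert_self i s)).add
      (ih fun j hj => h j (Finset.mem_insert_of_mem hj))

/-- Two-sided bounds are what makes products work: `2(ab - pq) = (a - p)(b + q) + (a + p)(b - q)`,
and likewise for `ab + pq`. -/
theorem mul (hp : SosBounded D c p) (hq : SosBounded E c' q) :
    SosBounded (D + E) (c * c') (p * q) where
  homogeneous := by
    rw [mul_add]; exact hp.homogeneous.mul hq.homogeneous
  upper := by
    have := C_mul_mem_sosCone (add_mem (mul_mem_sosCone hp.upper hq.lower)
      (mul_mem_sosCone hp.lower hq.upper)) (a := 1 / 2) (by norm_num)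
    convert this using 1
    have h2 : (C (1 / 2 : ℝ) : MvPolynomial (Fin n) ℝ) * 2 = 1 := by
      rw [← map_ofNat C 2, ← C.map_mul]; norm_num
    rw [C.map_mul, pow_add]
    linear_combination (-(C c * sqNorm n ^ D * (C c' * sqNorm n ^ E)) + p * q) * h2
  lower := by
    have := C_mul_mem_sosCone (add_mem (mul_mem_sosCone hp.lower hq.lower)
      (mul_mem_sosCone hp.upper hq.upper)) (a := 1 / 2) (by norm_num)
    convert this using 1
    have h2 : (C (1 / 2 : ℝ) : MvPolynomial (Fin n) ℝ) * 2 = 1 := by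
      rw [← map_ofNat C 2, ← C.map_mul]; norm_num
    rw [C.map_mul, pow_add]
    linear_combination (-(C c * sqNorm n ^ D * (C c' * sqNorm n ^ E)) - p * q) * h2

theorem one : SosBounded 0 1 (1 : MvPolynomial (Fin n) ℝ) where
  homogeneous := isHomogeneous_one _ _
  upper := by simp
  lower := by simpa using add_mem (one_mem_sosCone (n := n)) one_mem_sosCone

theorem pow (hp : SosBounded D c p) (r : ℕ) : SosBounded (D * r) (c ^ r) (p ^ r) := by
  induction r with
  | zero => simpa using one
  | succ r ih => rw [pow_succ, pow_succ, Nat.mul_succ]; exact ih.mul hp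

theorem sq_mul_sub_sq_mem (hp : SosBounded D c p) :
    C (c ^ 2) * sqNorm n ^ (2 * D) - p ^ 2 ∈ sosCone n (2 * D) := by
  simpa [mul_comm] using (hp.pow 2).upper

end SosBounded

/-- Lagrange's identity: the difference is half of `∑ (u_i - u_j)²` over all ordered pairs. -/
theorem card_mul_sum_sq_sub_sq_sum_mem_sosCone {ι : Type*} (T : Finset ι) {D : ℕ}
    (u : ι → MvPolynomial (Fin n) ℝ) (hu : ∀ i ∈ T, (u i).IsHomogeneous D) :
    C (T.card : ℝ) * ∑ i ∈ T, u i ^ 2 - (∑ i ∈ T, u i) ^ 2 ∈ sosCone n D := by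
  have h : ∑ i ∈ T, ∑ j ∈ T, (u i - u j) ^ 2 ∈ sosCone n D :=
    sum_mem fun i hi => sum_mem fun j hj => sq_mem_sosCone ((hu i hi).sub (hu j hj))
  convert C_mul_mem_sosCone h (a := 1 / 2) (by norm_num) using 1
  have h2 : (C (1 / 2 : ℝ) : MvPolynomial (Fin n) ℝ) * 2 = 1 := by
    rw [← map_ofNat C 2, ← C.map_mul]; norm_num
  have e : ∑ i ∈ T, ∑ j ∈ T, (u i - u j) ^ 2
      = 2 * ((T.card : MvPolynomial (Fin n) ℝ) * ∑ i ∈ T, u i ^ 2 - (∑ i ∈ T, u i) ^ 2) := by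
    simp only [sub_sq, Finset.sum_add_distrib, Finset.sum_sub_distrib, Finset.sum_const,
      nsmul_eq_mul, ← Finset.mul_sum, ← Finset.sum_mul, mul_assoc]
    ring
  rw [e, ← mul_assoc, h2, one_mul, map_natCast]

/-- The sum-of-squares bound for the square of `∑ x ^ α G_α` in terms of bounds for the `G_α`. -/
theorem sub_sq_sum_mem_sosCone {m E : ℕ} (G : (Fin n → ℕ) → MvPolynomial (Fin n) ℝ)
    (B : (Fin n → ℕ) → ℝ) (Q : ℝ)
    (hG : ∀ α ∈ Finset.piAntidiag Finset.univ m, SosBounded E (B α) (G α))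
    (hB : ∀ α ∈ Finset.piAntidiag Finset.univ m,
      B α ^ 2 ≤ Q * (Nat.multinomial Finset.univ α : ℝ)) :
    C (((Finset.piAntidiag (Finset.univ : Finset (Fin n)) m).card : ℝ) * Q) *
        sqNorm n ^ (m + 2 * E) -
      (∑ α ∈ Finset.piAntidiag Finset.univ m, (∏ i, X i ^ α i) * G α) ^ 2 ∈
        sosCone n (m + 2 * E) := by
  set T := Finset.piAntidiag (Finset.univ : Finset (Fin n)) m
  have hmon : ∀ α ∈ T, (∏ i, X i ^ α i : MvPolynomial (Fin n) ℝ).IsHomogeneous m := by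
    intro α hα
    have : ∑ i, α i = m := (Finset.mem_piAntidiag.1 hα).1
    rw [← this]
    exact IsHomogeneous.prod _ _ _ fun i _ => isHomogeneous_X_pow i _
  have h1 := card_mul_sum_sq_sub_sq_sum_mem_sosCone T (D := m + 2 * E)
    (fun α => (∏ i, X i ^ α i) * G α) fun α hα => (hmon α hα).mul (hG α hα).homogeneous
  -- Each `G_α²` is replaced by its upper bound; multiplying by the square of a monomial stays in
  -- the cone.
  have h2 : ∑ α ∈ T, (∏ i, X i ^ α i) ^ 2 *
      (C (Q * (Nat.multinomial Finset.univ α : ℝ)) * sqNorm n ^ (2 * E) - G α ^ 2) ∈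
        sosCone n (m + 2 * E) := by
    refine sum_mem fun α hα => mul_mem_sosCone (sq_mem_sosCone (hmon α hα)) ?_
    convert add_mem (hG α hα).sq_mul_sub_sq_mem (C_mul_mem_sosCone
      (sqNorm_pow_mem_sosCone (n := n) (2 * E)) (sub_nonneg.2 (hB α hα))) using 1
    rw [C_sub]; ring
  -- The multinomial weights allowed in `hB` are those of the expansion of `‖x‖^(2m)`, so nothing is
  -- lost when the bounds are summed.
  have h3 : sqNorm n ^ m = ∑ α ∈ T, C (Nat.multinomial Finset.univ α : ℝ) *
      (∏ i, X i ^ α i) ^ 2 := by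
    rw [sqNorm, Finset.sum_pow_eq_sum_piAntidiag]
    refine Finset.sum_congr rfl fun α _ => ?_
    rw [map_natCast, ← Finset.prod_pow]
    congr 1
    exact Finset.prod_congr rfl fun i _ => pow_right_comm _ _ _
  convert add_mem h1 (C_mul_mem_sosCone h2 (Nat.cast_nonneg T.card)) using 1
  rw [pow_add, h3, C.map_mul]
  simp only [mul_sub, Finset.sum_sub_distrib, mul_pow, C.map_mul, Finset.mul_sum, Finset.sum_mul]
  have : ∀ a b c d : MvPolynomial (Fin n) ℝ, c = a → a - d = b - d + (c - b) := by
    intro a b c d h; rw [h]; ring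
  refine this _ _ _ _ (Finset.sum_congr rfl fun α _ => by ring)

end SosCone

/-! ### Coefficients of a form by mixed finite differences. -/

section Extraction

open MvPolynomial

theorem eval_eq_sum_piAntidiag {R : Type*} [CommSemiring R] {n m : ℕ} {H : MvPolynomial (Fin n) R}
    (hH : H.IsHomogeneous m) (y : Fin n → R) :
    eval y H = ∑ γ ∈ Finset.piAntidiag Finset.univ m,
      coeff (Finsupp.equivFunOnFinite.symm γ) H * ∏ i, y i ^ γ i := by
  classical
  rw [eval_eq']
  refine Finset.sum_of_injOn (fun d : Fin n →₀ ℕ => (d : Fin n → ℕ))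
    (fun a _ b _ h => DFunLike.coe_injective h) ?_ ?_ ?_
  · intro d hd
    have := hH.degree_eq_sum_deg_support hd
    refine Finset.mem_coe.2 (Finset.mem_piAntidiag.2 ⟨?_, fun i _ => Finset.mem_univ i⟩)
    rw [this]
    exact (Finset.sum_subset (Finset.subset_univ _) (by simp)).symm
  · intro γ _ hγ
    have : coeff (Finsupp.equivFunOnFinite.symm γ) H = 0 := by
      by_contra h
      exact hγ ⟨Finsupp.equivFunOnFinite.symm γ, by simpa using h, by simp⟩
    rw [this, zero_mul]
  · intro d _
    have : Finsupp.equivFunOnFinite.symm (d : Fin n → ℕ) = d := by ext; simp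
    simp [this]

/-- The `a`-th finite difference kills powers below `a` and sends `t^a` to `a!`. -/
theorem sum_alternating_choose_mul_pow (a j : ℕ) (hj : j ≤ a) (l : ℝ) :
    ∑ s ∈ Finset.range (a + 1), ((-1 : ℝ) ^ (a - s) * a.choose s) * (l * s) ^ j =
      if j = a then l ^ a * a.factorial else 0 := by
  have h := fwdDiff_iter_eq_sum_shift (1 : ℝ) (fun r : ℝ => r ^ j) a 0
  have h' : ∑ s ∈ Finset.range (a + 1), ((-1 : ℝ) ^ (a - s) * a.choose s) * (l * s) ^ j =
      l ^ j * (fwdDiff (1 : ℝ))^[a] (fun r : ℝ => r ^ j) 0 := by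
    rw [h, Finset.mul_sum]
    refine Finset.sum_congr rfl fun s _ => ?_
    simp [mul_pow]
    ring
  rw [h']
  split_ifs with hja
  · subst hja
    rw [fwdDiff_iter_eq_factorial]
    simp
  · rw [fwdDiff_iter_pow_eq_zero_of_lt (lt_of_le_of_ne hj hja)]
    simp

/-- Equal total degree forces some exponent of `γ` to drop below that of `α`; in that variable the
difference vanishes, so only the monomial `α` survives. -/
theorem exists_lt_of_mem_piAntidiag {n m : ℕ} {α γ : Fin n → ℕ}
    (hα : α ∈ Finset.piAntidiag Finset.univ m) (hγ : γ ∈ Finset.piAntidiag Finset.univ m)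
    (hne : γ ≠ α) : ∃ i, γ i < α i := by
  by_contra! h
  have h1 : ∑ i, α i = ∑ i, γ i :=
    (Finset.mem_piAntidiag.1 hα).1.trans (Finset.mem_piAntidiag.1 hγ).1.symm
  exact hne (funext fun i =>
    ((Finset.sum_eq_sum_iff_of_le fun i _ => h i).1 h1 i (Finset.mem_univ i)).symm)

/-- The weights of the mixed finite difference of order `α`. -/
noncomputable def diffWeight {n : ℕ} (α s : Fin n → ℕ) : ℝ :=
  ∏ i, ((-1 : ℝ) ^ (α i - s i) * (α i).choose (s i))

theorem prod_sum_alternating {n m : ℕ} {α γ : Fin n → ℕ}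
    (hα : α ∈ Finset.piAntidiag Finset.univ m) (hγ : γ ∈ Finset.piAntidiag Finset.univ m)
    (l : Fin n → ℝ) :
    ∑ s ∈ Fintype.piFinset fun i => Finset.range (α i + 1),
      diffWeight α s * ∏ i, (l i * s i) ^ γ i =
      if γ = α then ∏ i, (l i ^ α i * (α i).factorial) else 0 := by
  have h : ∑ s ∈ Fintype.piFinset fun i => Finset.range (α i + 1),
      diffWeight α s * ∏ i, (l i * s i) ^ γ i =
      ∏ i, ∑ s ∈ Finset.range (α i + 1),
        ((-1 : ℝ) ^ (α i - s) * (α i).choose s) * (l i * s) ^ γ i := by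
    rw [Finset.prod_univ_sum]
    refine Finset.sum_congr rfl fun s _ => ?_
    rw [diffWeight, ← Finset.prod_mul_distrib]
  rw [h]
  split_ifs with hne
  · subst hne
    exact Finset.prod_congr rfl fun i _ => by
      rw [sum_alternating_choose_mul_pow _ _ le_rfl, if_pos rfl]
  · obtain ⟨i, hi⟩ := exists_lt_of_mem_piAntidiag hα hγ hne
    refine Finset.prod_eq_zero (Finset.mem_univ i) ?_
    rw [sum_alternating_choose_mul_pow _ _ hi.le, if_neg hi.ne]

/-- A coefficient of a form is recovered from values of the form by a mixed finite difference. -/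
theorem sum_diffWeight_smul_eval {R : Type*} [CommRing R] [Algebra ℝ R] {n m : ℕ}
    {H : MvPolynomial (Fin n) R} (hH : H.IsHomogeneous m) {α : Fin n → ℕ}
    (hα : α ∈ Finset.piAntidiag Finset.univ m) (l : Fin n → ℝ) :
    ∑ s ∈ Fintype.piFinset fun i => Finset.range (α i + 1),
      diffWeight α s • eval (fun i => algebraMap ℝ R (l i * s i)) H =
      (∏ i, (l i ^ α i * (α i).factorial)) • coeff (Finsupp.equivFunOnFinite.symm α) H := by
  have h1 : ∀ s : Fin n → ℕ, diffWeight α s • eval (fun i => algebraMap ℝ R (l i * s i)) H =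
      ∑ γ ∈ Finset.piAntidiag Finset.univ m,
        (diffWeight α s * ∏ i, (l i * s i) ^ γ i) •
          coeff (Finsupp.equivFunOnFinite.symm γ) H := by
    intro s
    rw [eval_eq_sum_piAntidiag hH, Finset.smul_sum]
    refine Finset.sum_congr rfl fun γ _ => ?_
    simp only [← map_pow, ← map_prod]
    rw [mul_comm (coeff _ _), ← Algebra.smul_def, smul_smul]
  simp only [h1]
  rw [Finset.sum_comm]
  simp only [← Finset.sum_smul]
  rw [Finset.sum_eq_single_of_mem α hα, prod_sum_alternating hα hα, if_pos rfl]
  intro γ hγ hne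
  rw [prod_sum_alternating hα hγ, if_neg hne, zero_smul]

theorem sum_abs_diffWeight {n m : ℕ} {α : Fin n → ℕ}
    (hα : α ∈ Finset.piAntidiag Finset.univ m) :
    ∑ s ∈ Fintype.piFinset fun i => Finset.range (α i + 1), |diffWeight α s| = 2 ^ m := by
  have h : ∑ s ∈ Fintype.piFinset fun i => Finset.range (α i + 1), |diffWeight α s| =
      ∏ i, ∑ s ∈ Finset.range (α i + 1), ((α i).choose s : ℝ) := by
    rw [Finset.prod_univ_sum]
    refine Finset.sum_congr rfl fun s _ => ?_
    simp [diffWeight, Finset.abs_prod, abs_mul]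
  have h' : ∀ a : ℕ, ∑ s ∈ Finset.range (a + 1), (a.choose s : ℝ) = 2 ^ a := fun a => by
    exact_mod_cast Nat.sum_range_choose a
  rw [h]
  simp only [h']
  rw [Finset.prod_pow_eq_pow_sum, (Finset.mem_piAntidiag.1 hα).1]

/-- Steps of length `1/√α_i` put the grid in the ball of radius `√m`, since `s_i²/α_i ≤ α_i`. For
`α_i = 0` the convention `0⁻¹ = 0` is harmless, as then `s_i = 0`. -/
theorem sum_sq_div_sqrt_le {n m : ℕ} {α s : Fin n → ℕ}
    (hα : α ∈ Finset.piAntidiag Finset.univ m)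
    (hs : s ∈ Fintype.piFinset fun i => Finset.range (α i + 1)) :
    ∑ i, ((Real.sqrt (α i))⁻¹ * s i) ^ 2 ≤ m := by
  have h : ∑ i, (α i : ℝ) = m := by exact_mod_cast (Finset.mem_piAntidiag.1 hα).1
  rw [← h]
  refine Finset.sum_le_sum fun i _ => ?_
  have hsi : (s i : ℝ) ≤ α i := by
    exact_mod_cast Nat.lt_succ_iff.1 (Finset.mem_range.1 (Fintype.mem_piFinset.1 hs i))
  rw [mul_pow, inv_pow, Real.sq_sqrt (Nat.cast_nonneg _)]
  rcases Nat.eq_zero_or_pos (α i) with h0 | h0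
  · simp [h0]
  · have : (0 : ℝ) < α i := by exact_mod_cast h0
    rw [inv_mul_le_iff₀ this]
    have := Nat.cast_nonneg (α := ℝ) (s i)
    nlinarith

end Extraction

/-! ### Matrix representations versus sum-of-squares certificates. -/

section Representation

open MvPolynomial

variable {n : ℕ}

/-- `R` is general because the tuple is used both for real points and for the variables `X i`
themselves. -/
theorem exists_tuple_prod_eq {R : Type*} [CommMonoid R] {D : ℕ} {α : Fin n → ℕ}
    (hα : α ∈ Finset.piAntidiag Finset.univ D) :
    ∃ I : Fin D → Fin n, ∀ x : Fin n → R, ∏ j, x (I j) = ∏ i, x i ^ α i := by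
  induction D generalizing α with
  | zero =>
    have h0 : ∀ i, α i = 0 := fun i =>
      (Finset.sum_eq_zero_iff.1 (Finset.mem_piAntidiag.1 hα).1) i (Finset.mem_univ i)
    exact ⟨Fin.elim0, fun x => by simp [h0]⟩
  | succ D ih =>
    have hsum : ∑ i, α i = D + 1 := (Finset.mem_piAntidiag.1 hα).1
    obtain ⟨k, -, hk⟩ : ∃ k ∈ Finset.univ, α k ≠ 0 := by
      refine Finset.exists_ne_zero_of_sum_ne_zero ?_
      rw [hsum]; omega
    have hupd : Function.update α k (α k - 1) ∈ Finset.piAntidiag Finset.univ D := by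
      refine Finset.mem_piAntidiag.2 ⟨?_, fun i _ => Finset.mem_univ i⟩
      have h1 := Finset.add_sum_erase Finset.univ α (Finset.mem_univ k)
      have h2 := Finset.add_sum_erase Finset.univ (Function.update α k (α k - 1))
        (Finset.mem_univ k)
      have h3 : ∑ i ∈ Finset.univ.erase k, Function.update α k (α k - 1) i =
          ∑ i ∈ Finset.univ.erase k, α i :=
        Finset.sum_congr rfl fun i hi => by simp [Finset.ne_of_mem_erase hi]
      simp only [Function.update_self] at h2
      change ∑ i, _ = _
      omega
    obtain ⟨I, hI⟩ := ih hupd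
    refine ⟨Fin.cons k I, fun x => ?_⟩
    rw [Fin.prod_univ_succ]
    simp only [Fin.cons_zero, Fin.cons_succ, hI]
    rw [← Finset.mul_prod_erase Finset.univ _ (Finset.mem_univ k),
      ← Finset.mul_prod_erase Finset.univ (fun i => x i ^ α i) (Finset.mem_univ k), ← mul_assoc]
    simp only [Function.update_self]
    rw [mul_pow_sub_one hk]
    congr 1
    exact Finset.prod_congr rfl fun i hi => by simp [Finset.ne_of_mem_erase hi]

theorem exists_dotProduct_tensorPow_eq {D : ℕ} {s : MvPolynomial (Fin n) ℝ}
    (hs : s.IsHomogeneous D) :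
    ∃ v : (Fin D → Fin n) → ℝ, ∀ x, v ⬝ᵥ tensorPow D x = eval x s := by
  classical
  choose I hI using fun α : Finset.piAntidiag (Finset.univ : Finset (Fin n)) D =>
    exists_tuple_prod_eq (R := ℝ) α.2
  refine ⟨∑ α ∈ (Finset.piAntidiag (Finset.univ : Finset (Fin n)) D).attach,
    (Pi.single (I α) (coeff (Finsupp.equivFunOnFinite.symm α.1) s) :
      (Fin D → Fin n) → ℝ), fun x => ?_⟩
  rw [eval_eq_sum_piAntidiag hs, sum_dotProduct, ← Finset.sum_attach (Finset.piAntidiag _ _)]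
  refine Finset.sum_congr rfl fun α _ => ?_
  rw [single_dotProduct, tensorPow, hI α]

theorem tensorPow_dotProduct_self (D : ℕ) (x : Fin n → ℝ) :
    tensorPow D x ⬝ᵥ tensorPow D x = (∑ i, x i ^ 2) ^ D := by
  rw [Finset.sum_pow' , Fintype.piFinset_univ]
  refine Finset.sum_congr rfl fun I _ => ?_
  rw [tensorPow, ← Finset.prod_mul_distrib]
  exact Finset.prod_congr rfl fun j _ => (sq _).symm

theorem exists_posSemidef_rep {D : ℕ} {p : MvPolynomial (Fin n) ℝ} (hp : p ∈ sosCone n D) :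
    ∃ P : Matrix (Fin D → Fin n) (Fin D → Fin n) ℝ, IsMatrixRep D P p ∧
      ∀ z, 0 ≤ z ⬝ᵥ (P *ᵥ z) := by
  induction hp using AddSubmonoid.closure_induction with
  | mem x hx =>
    obtain ⟨s, hs, rfl⟩ := hx
    obtain ⟨v, hv⟩ := exists_dotProduct_tensorPow_eq hs
    have key : ∀ z, z ⬝ᵥ (Matrix.vecMulVec v v *ᵥ z) = (v ⬝ᵥ z) ^ 2 := fun z => by
      rw [Matrix.vecMulVec_mulVec, dotProduct_comm z]
      simp [sq]
    refine ⟨Matrix.vecMulVec v v, ⟨?_, fun x => ?_⟩, fun z => ?_⟩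
    · ext i j; simp [Matrix.vecMulVec_apply, mul_comm]
    · rw [key, hv, map_pow]
    · rw [key]; positivity
  | zero => exact ⟨0, ⟨Matrix.isSymm_zero, by simp⟩, by simp⟩
  | add x y _ _ hx hy =>
    obtain ⟨P, ⟨hP, hPx⟩, hP0⟩ := hx
    obtain ⟨Q, ⟨hQ, hQy⟩, hQ0⟩ := hy
    refine ⟨P + Q, ⟨hP.add hQ, fun x => ?_⟩, fun z => ?_⟩
    · rw [Matrix.add_mulVec, dotProduct_add, hPx, hQy, map_add]
    · rw [Matrix.add_mulVec, dotProduct_add]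
      exact add_nonneg (hP0 z) (hQ0 z)

/-- `‖x‖^(2D)` is represented by the identity, so with `P` representing the certificate one takes `M
= cI - P`. -/
theorem exists_rep_le {D : ℕ} {c : ℝ} {p : MvPolynomial (Fin n) ℝ}
    (hp : C c * sqNorm n ^ D - p ∈ sosCone n D) :
    ∃ M : Matrix (Fin D → Fin n) (Fin D → Fin n) ℝ, IsMatrixRep D M p ∧
      ∀ z, z ⬝ᵥ (M *ᵥ z) ≤ c * (z ⬝ᵥ z) := by
  obtain ⟨P, ⟨hP, hPx⟩, hP0⟩ := exists_posSemidef_rep hp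
  have key : ∀ z, z ⬝ᵥ ((c • (1 : Matrix _ _ ℝ) - P) *ᵥ z) = c * (z ⬝ᵥ z) - z ⬝ᵥ (P *ᵥ z) :=
    fun z => by
      rw [Matrix.sub_mulVec, dotProduct_sub, Matrix.smul_mulVec, Matrix.one_mulVec,
        dotProduct_smul, smul_eq_mul]
  refine ⟨c • 1 - P, ⟨(Matrix.isSymm_one.smul c).sub hP, fun x => ?_⟩, fun z => ?_⟩
  · rw [key, hPx, tensorPow_dotProduct_self, map_sub, map_mul, eval_C, map_pow, eval_sqNorm]
    ring
  · rw [key]; linarith [hP0 z]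

variable {ι : Type*} [Fintype ι]

theorem abs_apply_le_one {z : EuclideanSpace ℝ ι} (hz : ‖z‖ = 1) (i : ι) : |z i| ≤ 1 := by
  rw [← hz, ← Real.norm_eq_abs]
  exact PiLp.norm_apply_le z i

theorem bddAbove_quadForm (M : Matrix ι ι ℝ) :
    BddAbove {t : ℝ | ∃ z : EuclideanSpace ℝ ι,
      ‖z‖ = 1 ∧ t = (fun i => z i) ⬝ᵥ (M *ᵥ fun i => z i)} := by
  refine ⟨∑ i, ∑ j, |M i j|, ?_⟩
  rintro _ ⟨z, hz, rfl⟩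
  refine Finset.sum_le_sum fun i _ => ?_
  simp only [Matrix.mulVec, dotProduct, Finset.mul_sum]
  refine Finset.sum_le_sum fun j _ => (le_abs_self _).trans ?_
  rw [abs_mul, abs_mul]
  have h1 := abs_apply_le_one hz i
  have h2 := abs_apply_le_one hz j
  calc |z i| * (|M i j| * |z j|) ≤ 1 * (|M i j| * 1) := by gcongr
    _ = |M i j| := by ring

theorem toLp_norm_eq_one {x : ι → ℝ} (hx : ∑ i, x i ^ 2 = 1) : ‖WithLp.toLp 2 x‖ = 1 := by
  rw [EuclideanSpace.norm_eq]
  simp [hx]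

theorem sum_sq_eq_one {z : EuclideanSpace ℝ ι} (hz : ‖z‖ = 1) : ∑ i, z i ^ 2 = 1 := by
  rw [← EuclideanSpace.real_norm_sq_eq, hz, one_pow]

theorem sum_inv_sqrt_smul_sq {x : ι → ℝ} (hx : 0 < ∑ i, x i ^ 2) :
    ∑ i, ((Real.sqrt (∑ i, x i ^ 2))⁻¹ * x i) ^ 2 = 1 := by
  simp only [mul_pow]
  rw [← Finset.mul_sum, inv_pow, Real.sq_sqrt hx.le, inv_mul_cancel₀ hx.ne']

theorem dotProduct_mulVec_le (M : Matrix ι ι ℝ) (z : ι → ℝ) :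
    z ⬝ᵥ (M *ᵥ z) ≤ maxQuadForm M * ∑ i, z i ^ 2 := by
  rcases (Finset.sum_nonneg fun i _ => sq_nonneg (z i) : 0 ≤ ∑ i, z i ^ 2).eq_or_lt with h | h
  · have h0 : z = 0 := funext fun i => by
      simpa using (Finset.sum_eq_zero_iff_of_nonneg fun i _ => sq_nonneg (z i)).1 h.symm i
        (Finset.mem_univ i)
    simp [h0]
  · set N := Real.sqrt (∑ i, z i ^ 2)
    have hN : N ^ 2 = ∑ i, z i ^ 2 := Real.sq_sqrt h.le
    have hNpos : 0 < N := Real.sqrt_pos.2 h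
    have h1 : (N⁻¹ • z) ⬝ᵥ (M *ᵥ (N⁻¹ • z)) ≤ maxQuadForm M :=
      le_csSup (bddAbove_quadForm M)
        ⟨WithLp.toLp 2 (N⁻¹ • z), toLp_norm_eq_one (sum_inv_sqrt_smul_sq h), rfl⟩
    rw [Matrix.mulVec_smul, dotProduct_smul, smul_dotProduct, smul_eq_mul, smul_eq_mul,
      ← mul_assoc, ← mul_inv, ← sq, inv_mul_le_iff₀ (by positivity), hN] at h1
    linarith

theorem eval_le_maxQuadForm {D : ℕ} {M : Matrix (Fin D → Fin n) (Fin D → Fin n) ℝ}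
    {p : MvPolynomial (Fin n) ℝ} (hM : IsMatrixRep D M p) {x : Fin n → ℝ}
    (hx : ∑ i, x i ^ 2 = 1) : eval x p ≤ maxQuadForm M := by
  have h := dotProduct_mulVec_le M (tensorPow D x)
  have h1 : ∑ I, tensorPow D x I ^ 2 = 1 := by
    have := tensorPow_dotProduct_self D x
    rw [hx, one_pow] at this
    simpa [dotProduct, sq] using this
  rwa [hM.2, h1, mul_one] at h

theorem exists_sum_sq_eq_one [Nonempty ι] : ∃ x : ι → ℝ, ∑ i, x i ^ 2 = 1 := by
  classical
  exact ⟨Pi.single (Classical.arbitrary ι) 1, by simp [Pi.single_apply]⟩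

theorem sosLambda_le {d : ℕ} [Nonempty (Fin n)] {c : ℝ} {p : MvPolynomial (Fin n) ℝ}
    (hp : C c * sqNorm n ^ (d / 2) - p ∈ sosCone n (d / 2)) : sosLambda d p ≤ c := by
  obtain ⟨M, hM, hMc⟩ := exists_rep_le hp
  obtain ⟨x, hx⟩ := exists_sum_sq_eq_one (ι := Fin n)
  -- The value of `p` at one unit vector bounds every admissible `maxQuadForm` from below, so the
  -- infimum is genuine.
  refine csInf_le_of_le ⟨eval x p, ?_⟩ ⟨M, hM, rfl⟩ ?_
  · rintro _ ⟨M, hM, rfl⟩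
    exact eval_le_maxQuadForm hM hx
  · obtain ⟨z, hz⟩ := exists_sum_sq_eq_one (ι := Fin (d / 2) → Fin n)
    refine csSup_le ⟨_, WithLp.toLp 2 z, toLp_norm_eq_one hz, rfl⟩ ?_
    rintro _ ⟨z, hz, rfl⟩
    refine (hMc _).trans_eq ?_
    have : (fun i => z i) ⬝ᵥ (fun i => z i) = 1 := by
      simpa [dotProduct, sq] using sum_sq_eq_one hz
    rw [this, mul_one]

/-- The bound on `p` serves only to supply a representation, so that the infimum is not over the
empty set. -/
theorem eval_le_sosLambda {d : ℕ} {c : ℝ} {p : MvPolynomial (Fin n) ℝ}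
    (hp : SosBounded (d / 2) c p) {x : Fin n → ℝ} (hx : ∑ i, x i ^ 2 = 1) :
    eval x p ≤ sosLambda d p := by
  obtain ⟨M, hM, -⟩ := exists_rep_le hp.upper
  refine le_csInf ⟨_, M, hM, rfl⟩ ?_
  rintro _ ⟨M, hM, rfl⟩
  exact eval_le_maxQuadForm hM hx

/-- Strictness provides an actual `M` with `cI - M` positive semidefinite; its decomposition into
rank-one matrices is the required sum of squares. -/
theorem sub_mem_sosCone_of_sosLambda_lt {d : ℕ} {c c' : ℝ} {p : MvPolynomial (Fin n) ℝ}
    (hp : SosBounded (d / 2) c' p) (hc : sosLambda d p < c) :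
    C c * sqNorm n ^ (d / 2) - p ∈ sosCone n (d / 2) := by
  classical
  obtain ⟨M₀, hM₀, -⟩ := exists_rep_le hp.upper
  obtain ⟨_, ⟨M, hM, rfl⟩, hlt⟩ := exists_lt_of_csInf_lt
    (s := {t : ℝ | ∃ M : Matrix (Fin (d / 2) → Fin n) (Fin (d / 2) → Fin n) ℝ,
      IsMatrixRep (d / 2) M p ∧ t = maxQuadForm M}) ⟨_, M₀, hM₀, rfl⟩ hc
  have key : ∀ z, z ⬝ᵥ ((c • (1 : Matrix _ _ ℝ) - M) *ᵥ z) = c * (z ⬝ᵥ z) - z ⬝ᵥ (M *ᵥ z) :=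
    fun z => by
      rw [Matrix.sub_mulVec, dotProduct_sub, Matrix.smul_mulVec, Matrix.one_mulVec,
        dotProduct_smul, smul_eq_mul]
  have hpos : (c • (1 : Matrix _ _ ℝ) - M).PosSemidef := by
    refine .of_dotProduct_mulVec_nonneg ?_ fun z => ?_
    · have := (Matrix.isSymm_one.smul c).sub hM.1
      rw [Matrix.IsHermitian, Matrix.conjTranspose_eq_transpose_of_trivial]
      exact this
    · have h1 := dotProduct_mulVec_le M z
      have h2 : 0 ≤ ∑ i, z i ^ 2 := Finset.sum_nonneg fun i _ => sq_nonneg (z i)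
      have h3 : z ⬝ᵥ z = ∑ i, z i ^ 2 := by simp [dotProduct, sq]
      rw [star_trivial, key, h3]
      nlinarith
  obtain ⟨k, v, hv⟩ := Matrix.posSemidef_iff_eq_sum_vecMulVec.1 hpos
  have heq : C c * sqNorm n ^ (d / 2) - p =
      ∑ J, (∑ I, C (v J I) * ∏ j, X (I j)) ^ 2 := by
    refine MvPolynomial.funext fun x => ?_
    have h1 := key (tensorPow (d / 2) x)
    rw [hv, hM.2, tensorPow_dotProduct_self, Matrix.sum_mulVec, dotProduct_sum] at h1
    simp only [map_sub, map_mul, eval_C, map_pow, eval_sqNorm, map_sum, map_prod, eval_X]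
    rw [← h1]
    refine Finset.sum_congr rfl fun J _ => ?_
    rw [Matrix.vecMulVec_mulVec, star_trivial, dotProduct_smul, dotProduct_comm (tensorPow _ x),
      MulOpposite.smul_eq_mul_unop, MulOpposite.unop_op, ← sq]
    rfl
  rw [heq]
  refine sum_mem fun J _ => sq_mem_sosCone ?_
  refine IsHomogeneous.sum _ _ _ fun I _ => IsHomogeneous.C_mul ?_ _
  simpa using IsHomogeneous.prod Finset.univ (fun j => (X (I j) : MvPolynomial (Fin n) ℝ))
    (fun _ => 1) fun j _ => isHomogeneous_X ℝ (I j)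

end Representation

/-! ### Sup norms on the sphere, and a crude bound valid for every form. -/

section Norms

open MvPolynomial

variable {n : ℕ}

theorem abs_eval_le_sum_abs_coeff (p : MvPolynomial (Fin n) ℝ) {x : Fin n → ℝ}
    (hx : ∀ i, |x i| ≤ 1) : |eval x p| ≤ ∑ d ∈ p.support, |coeff d p| := by
  rw [eval_eq']
  refine (Finset.abs_sum_le_sum_abs _ _).trans (Finset.sum_le_sum fun d _ => ?_)
  rw [abs_mul, Finset.abs_prod]
  refine mul_le_of_le_one_right (abs_nonneg _) (Finset.prod_le_one (fun i _ => abs_nonneg _) ?_)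
  intro i _
  rw [abs_pow]
  exact pow_le_one₀ (abs_nonneg _) (hx i)

theorem abs_eval_le_sphereNorm (p : MvPolynomial (Fin n) ℝ) {x : Fin n → ℝ}
    (hx : ∑ i, x i ^ 2 = 1) : |eval x p| ≤ sphereNorm p := by
  refine le_csSup ⟨∑ d ∈ p.support, |coeff d p|, ?_⟩ ⟨WithLp.toLp 2 x, toLp_norm_eq_one hx, rfl⟩
  rintro _ ⟨z, hz, rfl⟩
  exact abs_eval_le_sum_abs_coeff p (abs_apply_le_one hz)

theorem sphereNorm_le [Nonempty (Fin n)] {p : MvPolynomial (Fin n) ℝ} {c : ℝ}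
    (h : ∀ x : Fin n → ℝ, ∑ i, x i ^ 2 = 1 → |eval x p| ≤ c) : sphereNorm p ≤ c := by
  obtain ⟨x, hx⟩ := exists_sum_sq_eq_one (ι := Fin n)
  refine csSup_le ⟨_, WithLp.toLp 2 x, toLp_norm_eq_one hx, rfl⟩ ?_
  rintro _ ⟨z, hz, rfl⟩
  exact h _ (sum_sq_eq_one hz)

theorem sphereNorm_nonneg (p : MvPolynomial (Fin n) ℝ) : 0 ≤ sphereNorm p := by
  refine Real.sSup_nonneg ?_
  rintro _ ⟨z, -, rfl⟩
  exact abs_nonneg _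

theorem sphereNorm_neg (p : MvPolynomial (Fin n) ℝ) : sphereNorm (-p) = sphereNorm p := by
  simp [sphereNorm]

theorem eval_const_mul {m : ℕ} {p : MvPolynomial (Fin n) ℝ} (hp : p.IsHomogeneous m) (a : ℝ)
    (x : Fin n → ℝ) : eval (fun i => a * x i) p = a ^ m * eval x p := by
  rw [eval_eq_sum_piAntidiag hp, eval_eq_sum_piAntidiag hp, Finset.mul_sum]
  refine Finset.sum_congr rfl fun α hα => ?_
  have : ∑ i, α i = m := (Finset.mem_piAntidiag.1 hα).1
  simp only [mul_pow, Finset.prod_mul_distrib, Finset.prod_pow_eq_pow_sum, this]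
  ring

theorem abs_eval_le_pow_mul_sphereNorm [Nonempty (Fin n)] {m : ℕ} {p : MvPolynomial (Fin n) ℝ}
    (hp : p.IsHomogeneous m) {x : Fin n → ℝ} {R : ℝ} (hR : 0 ≤ R) (hx : ∑ i, x i ^ 2 ≤ R ^ 2) :
    |eval x p| ≤ R ^ m * sphereNorm p := by
  rcases (Finset.sum_nonneg fun i _ => sq_nonneg (x i) : 0 ≤ ∑ i, x i ^ 2).eq_or_lt with h | h
  · obtain ⟨u, hu⟩ := exists_sum_sq_eq_one (ι := Fin n)
    have h0 : x = fun i => 0 * u i := funext fun i => by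
      simpa using (Finset.sum_eq_zero_iff_of_nonneg fun i _ => sq_nonneg (x i)).1 h.symm i
        (Finset.mem_univ i)
    rw [h0, eval_const_mul hp, abs_mul, abs_pow, abs_zero]
    exact mul_le_mul (pow_le_pow_left₀ le_rfl hR m) (abs_eval_le_sphereNorm p hu)
      (abs_nonneg _) (pow_nonneg hR m)
  · set N := Real.sqrt (∑ i, x i ^ 2)
    have hN : 0 < N := Real.sqrt_pos.2 h
    have hNR : N ≤ R := Real.sqrt_le_iff.2 ⟨hR, hx⟩
    have h0 : x = fun i => N * (N⁻¹ * x i) := funext fun i => by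
      rw [mul_inv_cancel_left₀ hN.ne']
    rw [h0, eval_const_mul hp, abs_mul, abs_pow, abs_of_pos hN]
    exact mul_le_mul (pow_le_pow_left₀ hN.le hNR m)
      (abs_eval_le_sphereNorm p (sum_inv_sqrt_smul_sq h)) (abs_nonneg _) (pow_nonneg hR m)

/-- For fixed `x`, `y ↦ h(y)(x)` is thus an ordinary real form of degree `d₁`, to which homogeneity
applies. -/
theorem eval_foldedEval (h : PolyCoeffPoly n) (x y : Fin n → ℝ) :
    eval x (foldedEval y h) = eval y (map (eval x) h) := by
  rw [foldedEval, eval_map, ← coe_eval₂Hom, ← RingHom.comp_apply]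
  congr 1
  refine MvPolynomial.ringHom_ext (fun r => ?_) fun i => ?_ <;> simp

theorem sphereNorm_foldedEval_le_foldedSup [Nonempty (Fin n)] (h : PolyCoeffPoly n)
    {y : Fin n → ℝ} (hy : ∑ i, y i ^ 2 = 1) :
    sphereNorm (foldedEval y h) ≤ foldedSup h := by
  refine le_csSup ⟨∑ d ∈ h.support, ∑ e ∈ (coeff d h).support, |coeff e (coeff d h)|, ?_⟩
    ⟨WithLp.toLp 2 y, toLp_norm_eq_one hy, rfl⟩
  rintro _ ⟨z, hz, rfl⟩
  refine sphereNorm_le fun x hx => ?_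
  have hx1 : ∀ i, |x i| ≤ 1 := abs_apply_le_one (toLp_norm_eq_one hx)
  rw [eval_foldedEval]
  refine (abs_eval_le_sum_abs_coeff _ (abs_apply_le_one hz)).trans ?_
  refine (Finset.sum_le_sum_of_subset_of_nonneg (support_map_subset _ _)
    fun _ _ _ => abs_nonneg _).trans (Finset.sum_le_sum fun d _ => ?_)
  rw [coeff_map]
  exact abs_eval_le_sum_abs_coeff _ hx1

theorem foldedSup_nonneg (h : PolyCoeffPoly n) : 0 ≤ foldedSup h := by
  refine Real.sSup_nonneg ?_
  rintro _ ⟨z, -, rfl⟩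
  exact sphereNorm_nonneg _

theorem sphereNorm_foldedEval_le_pow_mul [Nonempty (Fin n)] {d₁ : ℕ} {h : PolyCoeffPoly n}
    (hh : h.IsHomogeneous d₁) {y : Fin n → ℝ} {R : ℝ} (hR : 0 ≤ R) (hy : ∑ i, y i ^ 2 ≤ R ^ 2) :
    sphereNorm (foldedEval y h) ≤ R ^ d₁ * foldedSup h := by
  refine sphereNorm_le fun x hx => ?_
  rw [eval_foldedEval]
  refine (abs_eval_le_pow_mul_sphereNorm (hh.map _) hR hy).trans ?_
  refine mul_le_mul_of_nonneg_left (sphereNorm_le fun z hz => ?_) (pow_nonneg hR _)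
  rw [← eval_foldedEval]
  exact (abs_eval_le_sphereNorm _ hx).trans (sphereNorm_foldedEval_le_foldedSup h hz)

theorem X_mul_X_sosBounded (i j : Fin n) :
    SosBounded 1 1 (X i * X j : MvPolynomial (Fin n) ℝ) := by
  classical
  -- Used through `2(‖x‖² ∓ x_i x_j) = (‖x‖² - x_i²) + (‖x‖² - x_j²) + (x_i ∓ x_j)²`, valid also for
  -- `i = j`.
  have hle : ∀ k : Fin n, sqNorm n - X k ^ 2 ∈ sosCone n 1 := fun k => by
    rw [sqNorm, ← Finset.add_sum_erase _ _ (Finset.mem_univ k), add_sub_cancel_left]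
    exact sum_mem fun i _ => sq_mem_sosCone (isHomogeneous_X ℝ i)
  have h2 : (C (1 / 2 : ℝ) : MvPolynomial (Fin n) ℝ) * 2 = 1 := by
    rw [← map_ofNat C 2, ← C.map_mul]; norm_num
  refine ⟨(isHomogeneous_X ℝ i).mul (isHomogeneous_X ℝ j), ?_, ?_⟩
  · have := C_mul_mem_sosCone (add_mem (add_mem (hle i) (hle j)) (sq_mem_sosCone
      ((isHomogeneous_X ℝ i).sub (isHomogeneous_X ℝ j)))) (a := 1 / 2) (by norm_num)
    convert this using 1
    rw [C_1]
    linear_combination (X i * X j - sqNorm n) * h2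
  · have := C_mul_mem_sosCone (add_mem (add_mem (hle i) (hle j)) (sq_mem_sosCone
      ((isHomogeneous_X ℝ i).add (isHomogeneous_X ℝ j)))) (a := 1 / 2) (by norm_num)
    convert this using 1
    rw [C_1]
    linear_combination (-X i * X j - sqNorm n) * h2

theorem prod_X_sosBounded {D : ℕ} (I : Fin (2 * D) → Fin n) :
    SosBounded D 1 (∏ j, X (I j) : MvPolynomial (Fin n) ℝ) := by
  induction D with
  | zero => simpa using SosBounded.one
  | succ D ih =>
    have : (∏ j, X (I j) : MvPolynomial (Fin n) ℝ) =
        (∏ j : Fin (2 * D), X (I j.castSucc.castSucc)) *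
          (X (I (Fin.last (2 * D)).castSucc) * X (I (Fin.last (2 * D + 1)))) := by
      rw [← mul_assoc]
      exact (Fin.prod_univ_castSucc _).trans (congrArg (· * _) (Fin.prod_univ_castSucc _))
    rw [this]
    simpa using (ih _).mul (X_mul_X_sosBounded _ _)

theorem monomial_sosBounded {D : ℕ} {α : Fin n → ℕ}
    (hα : α ∈ Finset.piAntidiag Finset.univ (2 * D)) :
    SosBounded D 1 (∏ i, X i ^ α i : MvPolynomial (Fin n) ℝ) := by
  obtain ⟨I, hI⟩ := exists_tuple_prod_eq (R := MvPolynomial (Fin n) ℝ) hα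
  rw [← hI]
  exact prod_X_sosBounded I

theorem eq_sum_C_mul_monomial {m : ℕ} {p : MvPolynomial (Fin n) ℝ} (hp : p.IsHomogeneous m) :
    p = ∑ α ∈ Finset.piAntidiag Finset.univ m,
      C (coeff (Finsupp.equivFunOnFinite.symm α) p) * ∏ i, X i ^ α i := by
  refine MvPolynomial.funext fun x => ?_
  rw [eval_eq_sum_piAntidiag hp]
  simp

theorem abs_coeff_le [Nonempty (Fin n)] {m : ℕ} {p : MvPolynomial (Fin n) ℝ}
    (hp : p.IsHomogeneous m) {α : Fin n → ℕ} (hα : α ∈ Finset.piAntidiag Finset.univ m) :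
    |coeff (Finsupp.equivFunOnFinite.symm α) p| ≤ 2 ^ m * (m ^ m * sphereNorm p) := by
  have h := sum_diffWeight_smul_eval hp hα fun _ => 1
  have hsum : ∑ i, α i = m := (Finset.mem_piAntidiag.1 hα).1
  have h1 : (1 : ℝ) ≤ ∏ i, (1 ^ α i * ((α i).factorial : ℝ)) := by
    simp only [one_pow, one_mul]
    exact_mod_cast Finset.one_le_prod'' fun i => Nat.succ_le_of_lt (Nat.factorial_pos (α i))
  calc |coeff (Finsupp.equivFunOnFinite.symm α) p|
      ≤ |(∏ i, (1 ^ α i * ((α i).factorial : ℝ))) •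
          coeff (Finsupp.equivFunOnFinite.symm α) p| := by
        rw [smul_eq_mul, abs_mul, abs_of_nonneg (zero_le_one.trans h1)]
        exact le_mul_of_one_le_left (abs_nonneg _) h1
    _ ≤ ∑ s ∈ Fintype.piFinset fun i => Finset.range (α i + 1),
          |diffWeight α s| * (m ^ m * sphereNorm p) := by
        rw [← h]
        refine (Finset.abs_sum_le_sum_abs _ _).trans (Finset.sum_le_sum fun s hs => ?_)
        rw [smul_eq_mul, abs_mul]
        refine mul_le_mul_of_nonneg_left ?_ (abs_nonneg _)
        refine abs_eval_le_pow_mul_sphereNorm hp (Nat.cast_nonneg m) ?_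
        have hs' : ∑ i, s i ^ 2 ≤ m ^ 2 := by
          rw [← hsum]
          rw [sq, Finset.sum_mul]
          refine Finset.sum_le_sum fun i _ => ?_
          rw [sq]
          have hsi : s i ≤ α i := Nat.lt_succ_iff.1
            (Finset.mem_range.1 (Fintype.mem_piFinset.1 hs i))
          exact Nat.mul_le_mul hsi (hsi.trans
            (Finset.single_le_sum (fun _ _ => Nat.zero_le _) (Finset.mem_univ i)))
        simp only [one_mul, Algebra.algebraMap_self, RingHom.id_apply]
        exact_mod_cast hs'
    _ = 2 ^ m * (m ^ m * sphereNorm p) := by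
        rw [← Finset.sum_mul, sum_abs_diffWeight hα]

/-- Only finiteness matters: it makes the supremum defining `foldGamma` bounded and the infima
defining `sosLambda` nonempty. The constant depends on `n` and `D` and does not enter the final
estimate. -/
theorem exists_sosBounded (n D : ℕ) [Nonempty (Fin n)] : ∃ c₀ : ℝ, 0 ≤ c₀ ∧
    ∀ p : MvPolynomial (Fin n) ℝ, p.IsHomogeneous (2 * D) →
      SosBounded D (c₀ * sphereNorm p) p := by
  refine ⟨∑ _α ∈ Finset.piAntidiag (Finset.univ : Finset (Fin n)) (2 * D),
    2 ^ (2 * D) * ((2 * D : ℕ) : ℝ) ^ (2 * D), by positivity, fun p hp => ?_⟩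
  rw [Finset.sum_mul]
  conv => arg 3; rw [eq_sum_C_mul_monomial hp]
  refine SosBounded.sum _ _ _ fun α hα => ((monomial_sosBounded hα).C_mul _).mono ?_
  rw [mul_one, mul_assoc]
  exact abs_coeff_le hp hα

end Norms

/-! ### From `Γ` to two-sided sum-of-squares bounds on the span of the folds. -/

section Folds

open MvPolynomial

variable {n : ℕ} {d₁ d₂ : ℕ} {h : PolyCoeffPoly n}

theorem IsFolded.isHomogeneous_of_mem (hh : IsFolded d₁ d₂ h) {p : MvPolynomial (Fin n) ℝ}
    (hp : p ∈ foldSpan d₁ h) : p.IsHomogeneous d₂ := by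
  have : foldSpan d₁ h ≤ homogeneousSubmodule (Fin n) ℝ d₂ := by
    refine Submodule.span_le.2 ?_
    rintro _ ⟨β, -, rfl⟩
    exact hh.folds β
  exact this hp

theorem IsFolded.foldedEval_mem (hh : IsFolded d₁ d₂ h) (y : Fin n → ℝ) :
    foldedEval y h ∈ foldSpan d₁ h := by
  rw [foldedEval, eval_eq_sum_piAntidiag hh.monomials]
  refine sum_mem fun γ hγ => ?_
  simp only [← map_pow, ← map_prod]
  rw [mul_comm, ← smul_eq_C_mul]
  refine Submodule.smul_mem _ _ (Submodule.subset_span ⟨_, ?_, rfl⟩)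
  change Finsupp.degree _ = d₁
  rw [Finsupp.degree_eq_sum]
  exact (Finset.mem_piAntidiag.1 hγ).1

theorem IsFolded.sosLambda_le_foldGamma_mul [Nonempty (Fin n)] (hh : IsFolded d₁ d₂ h)
    (hd : Even d₂) {p : MvPolynomial (Fin n) ℝ} (hp : p ∈ foldSpan d₁ h) :
    sosLambda d₂ p ≤ foldGamma d₁ d₂ h * sphereNorm p := by
  obtain ⟨c₀, hc₀, hc⟩ := exists_sosBounded n (d₂ / 2)
  rw [Nat.mul_div_cancel' hd.two_dvd] at hc
  have hle : ∀ p ∈ foldSpan d₁ h, sosLambda d₂ p ≤ c₀ * sphereNorm p := fun p hp =>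
    sosLambda_le (hc p (hh.isHomogeneous_of_mem hp)).upper
  rcases (sphereNorm_nonneg p).eq_or_lt with h0 | h0
  -- When the norm is zero the ratio carries no information, but the crude bound already gives `Λ(p)
  -- ≤ 0`.
  · simpa [← h0] using hle p hp
  · rw [← div_le_iff₀ h0]
    refine le_csSup ⟨c₀, ?_⟩ ⟨p, hp, ?_, rfl⟩
    · rintro _ ⟨p, hp, -, rfl⟩
      exact div_le_of_le_mul₀ (sphereNorm_nonneg p) hc₀ (hle p hp)
    · rintro rfl
      have : sphereNorm (0 : MvPolynomial (Fin n) ℝ) ≤ 0 := sphereNorm_le fun x _ => by simp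
      exact absurd h0 this.not_gt

/-- `Λ` is one-sided, but the span contains `-p` with the same norm, so `Γ` controls both signs. -/
theorem IsFolded.sosBounded [Nonempty (Fin n)] (hh : IsFolded d₁ d₂ h) (hd : Even d₂)
    {p : MvPolynomial (Fin n) ℝ} (hp : p ∈ foldSpan d₁ h) {c : ℝ}
    (hc : foldGamma d₁ d₂ h * sphereNorm p < c) : SosBounded (d₂ / 2) c p := by
  obtain ⟨c₀, -, hc₀⟩ := exists_sosBounded n (d₂ / 2)
  have hp' := hh.isHomogeneous_of_mem hp
  have hn := neg_mem hp
  have h2 : 2 * (d₂ / 2) = d₂ := Nat.mul_div_cancel' hd.two_dvd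
  have hb := hc₀ p (by rwa [h2])
  refine ⟨hb.homogeneous, ?_, ?_⟩
  · exact sub_mem_sosCone_of_sosLambda_lt hb
      ((hh.sosLambda_le_foldGamma_mul hd hp).trans_lt hc)
  · have := sub_mem_sosCone_of_sosLambda_lt hb.neg (c := c)
      ((hh.sosLambda_le_foldGamma_mul hd hn).trans_lt (by rwa [sphereNorm_neg]))
    rwa [sub_neg_eq_add] at this

/-- Adding the bounds for `p` and `-p` at a unit vector gives `0 ≤ 2Γ‖p‖₂`. If `Γ < 0`, all norms
vanish, every ratio is `0` by the convention on division, and the supremum is not negative after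
all. -/
theorem IsFolded.foldGamma_nonneg [Nonempty (Fin n)] (hh : IsFolded d₁ d₂ h) (hd : Even d₂) :
    0 ≤ foldGamma d₁ d₂ h := by
  obtain ⟨c₀, -, hc₀⟩ := exists_sosBounded n (d₂ / 2)
  rw [Nat.mul_div_cancel' hd.two_dvd] at hc₀
  obtain ⟨x, hx⟩ := exists_sum_sq_eq_one (ι := Fin n)
  by_contra! hneg
  refine hneg.not_ge (Real.sSup_nonneg ?_)
  rintro _ ⟨p, hp, -, rfl⟩
  have hb := hc₀ p (hh.isHomogeneous_of_mem hp)
  have h1 := (eval_le_sosLambda hb hx).trans (hh.sosLambda_le_foldGamma_mul hd hp)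
  have h2 := (eval_le_sosLambda hb.neg hx).trans (hh.sosLambda_le_foldGamma_mul hd (neg_mem hp))
  rw [sphereNorm_neg, map_neg] at h2
  have h3 : sphereNorm p = 0 := by
    have := sphereNorm_nonneg p
    nlinarith
  simp [h3]

end Folds

/-! ### Folds of `h^r`, counting exponents, and the final estimate. -/

section PowerOfFolded

open MvPolynomial

variable {n : ℕ} {d₁ d₂ : ℕ} {h : PolyCoeffPoly n}

theorem inv_sq_sqrt_pow_mul_factorial_le (a : ℕ) :
    (((Real.sqrt a)⁻¹ ^ a * a.factorial) ^ 2)⁻¹ ≤ Real.exp 1 ^ a / a.factorial := by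
  have hf : (0 : ℝ) < a.factorial := by exact_mod_cast Nat.factorial_pos a
  have h1 : (((Real.sqrt a)⁻¹ ^ a * a.factorial) ^ 2)⁻¹ =
      ((a : ℝ) ^ a / a.factorial) / a.factorial := by
    rw [mul_pow, pow_right_comm, inv_pow, Real.sq_sqrt (Nat.cast_nonneg a), mul_inv, inv_pow,
      inv_inv, div_div, div_eq_mul_inv, sq]
  rw [h1, ← Real.exp_nat_mul, mul_one]
  gcongr
  exact Real.pow_div_factorial_le_exp _ (Nat.cast_nonneg a) a

/-- The constant by which the mixed finite difference of order `α` multiplies a coefficient. -/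
noncomputable def diffScale (α : Fin n → ℕ) : ℝ :=
  ∏ i, ((Real.sqrt (α i))⁻¹ ^ α i * (α i).factorial)

theorem diffScale_pos (α : Fin n → ℕ) : 0 < diffScale α := by
  refine Finset.prod_pos fun i _ => ?_
  have hf : (0 : ℝ) < (α i).factorial := by exact_mod_cast Nat.factorial_pos _
  rcases Nat.eq_zero_or_pos (α i) with h0 | h0
  · simp [h0]
  · have : (0 : ℝ) < α i := by exact_mod_cast h0
    positivity

/-- Both factors use `a^a ≤ e^a a!`: once per `α_i`, which leaves `1/∏ α_i!`, and once for `m`,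
which supplies `m!`. Together they form the multinomial coefficient. -/
theorem inv_sq_diffScale_mul_pow_le {m : ℕ} {α : Fin n → ℕ}
    (hα : α ∈ Finset.piAntidiag Finset.univ m) :
    (diffScale α ^ 2)⁻¹ * (m : ℝ) ^ m ≤
      (Real.exp 1 ^ 2) ^ m * (Nat.multinomial Finset.univ α : ℝ) := by
  have hsum : ∑ i, α i = m := (Finset.mem_piAntidiag.1 hα).1
  have h1 : (diffScale α ^ 2)⁻¹ ≤ Real.exp 1 ^ m / ∏ i, ((α i).factorial : ℝ) := by
    rw [diffScale, ← Finset.prod_pow, ← Finset.prod_inv_distrib, ← hsum,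
      ← Finset.prod_pow_eq_pow_sum, ← Finset.prod_div_distrib]
    exact Finset.prod_le_prod (fun i _ => by positivity)
      fun i _ => inv_sq_sqrt_pow_mul_factorial_le (α i)
  have h2 : (m : ℝ) ^ m ≤ Real.exp 1 ^ m * m.factorial := by
    rw [← div_le_iff₀ (by exact_mod_cast Nat.factorial_pos m), ← Real.exp_nat_mul, mul_one]
    exact Real.pow_div_factorial_le_exp _ (Nat.cast_nonneg m) m
  have h3 : (∏ i, ((α i).factorial : ℝ)) * (Nat.multinomial Finset.univ α : ℝ) = m.factorial := by
    rw [← hsum]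
    exact_mod_cast Nat.multinomial_spec Finset.univ α
  have h4 : (0 : ℝ) < ∏ i, ((α i).factorial : ℝ) :=
    Finset.prod_pos fun i _ => by exact_mod_cast Nat.factorial_pos _
  calc (diffScale α ^ 2)⁻¹ * (m : ℝ) ^ m
      ≤ (Real.exp 1 ^ m / ∏ i, ((α i).factorial : ℝ)) * (Real.exp 1 ^ m * m.factorial) := by
        gcongr
    _ = _ := by
        rw [← h3]
        field_simp
        ring

theorem IsFolded.foldedEval_sosBounded [Nonempty (Fin n)] (hh : IsFolded d₁ d₂ h) (hd : Even d₂)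
    {c S : ℝ} (hS : foldedSup h ≤ S) (hc : foldGamma d₁ d₂ h * S < c) {y : Fin n → ℝ} {R : ℝ}
    (hR : 0 ≤ R) (hR' : 0 < R ^ d₁) (hy : ∑ i, y i ^ 2 ≤ R ^ 2) :
    SosBounded (d₂ / 2) (R ^ d₁ * c) (foldedEval y h) := by
  refine hh.sosBounded hd (hh.foldedEval_mem y) ?_
  have hΓ := hh.foldGamma_nonneg hd
  calc foldGamma d₁ d₂ h * sphereNorm (foldedEval y h)
      ≤ foldGamma d₁ d₂ h * (R ^ d₁ * S) := by
        gcongr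
        exact (sphereNorm_foldedEval_le_pow_mul hh.monomials hR hy).trans (by gcongr)
    _ = R ^ d₁ * (foldGamma d₁ d₂ h * S) := by ring
    _ < R ^ d₁ * c := by gcongr

/-- The folds of a power of a folded polynomial are bounded in the sum-of-squares order. -/
theorem IsFolded.coeff_pow_sosBounded [Nonempty (Fin n)] (hh : IsFolded d₁ d₂ h) (hd : Even d₂)
    {c S : ℝ} (hS : foldedSup h ≤ S) (hc : foldGamma d₁ d₂ h * S < c) {r : ℕ} (hr : 0 < r)
    {α : Fin n → ℕ} (hα : α ∈ Finset.piAntidiag Finset.univ (d₁ * r)) :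
    SosBounded (d₂ / 2 * r)
      ((diffScale α)⁻¹ * (2 ^ (d₁ * r) * (Real.sqrt (d₁ * r : ℕ) ^ d₁ * c) ^ r))
      (coeff (Finsupp.equivFunOnFinite.symm α) (h ^ r)) := by
  set R := Real.sqrt (d₁ * r : ℕ)
  have hR' : 0 < R ^ d₁ := by
    rcases Nat.eq_zero_or_pos d₁ with h0 | h0
    -- For `d₁ = 0` the radius is `0`, but `0 ^ 0 = 1`.
    · simp [h0]
    · exact pow_pos (Real.sqrt_pos.2 (by exact_mod_cast Nat.mul_pos h0 hr)) _
  have hsum := sum_diffWeight_smul_eval (hh.monomials.pow r) hα fun i => (Real.sqrt (α i))⁻¹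
  have hb : SosBounded (d₂ / 2 * r) (2 ^ (d₁ * r) * (R ^ d₁ * c) ^ r)
      (C (diffScale α) * coeff (Finsupp.equivFunOnFinite.symm α) (h ^ r)) := by
    rw [← smul_eq_C_mul, diffScale, ← hsum, ← sum_abs_diffWeight hα, Finset.sum_mul]
    refine SosBounded.sum _ _ _ fun s hs => ?_
    rw [smul_eq_C_mul, map_pow]
    refine (SosBounded.pow ?_ r).C_mul _
    refine hh.foldedEval_sosBounded hd hS hc (Real.sqrt_nonneg _) hR' ?_
    rw [Real.sq_sqrt (Nat.cast_nonneg _)]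
    exact sum_sq_div_sqrt_le hα hs
  have := hb.C_mul (diffScale α)⁻¹
  rwa [abs_of_pos (inv_pos.2 (diffScale_pos α)), ← mul_assoc (C _), ← C.map_mul,
    inv_mul_cancel₀ (diffScale_pos α).ne', C_1, one_mul] at this

theorem IsFolded.sub_unfolding_pow_mem_sosCone [Nonempty (Fin n)] (hh : IsFolded d₁ d₂ h)
    (hd : Even d₂) {c S : ℝ} (hS : foldedSup h ≤ S) (hc : foldGamma d₁ d₂ h * S < c) {r : ℕ}
    (hr : 0 < r) :
    C (((Finset.piAntidiag (Finset.univ : Finset (Fin n)) (d₁ * r)).card : ℝ) *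
        ((4 * Real.exp 1 ^ 2) ^ (d₁ * r) * c ^ (2 * r))) *
        sqNorm n ^ ((d₁ + d₂) * r) - unfolding h ^ (2 * r) ∈ sosCone n ((d₁ + d₂) * r) := by
  have h1 := sub_sq_sum_mem_sosCone
    (fun α => coeff (Finsupp.equivFunOnFinite.symm α) (h ^ r)) _
    ((4 * Real.exp 1 ^ 2) ^ (d₁ * r) * c ^ (2 * r))
    (fun α hα => hh.coeff_pow_sosBounded hd hS hc hr hα) fun α hα => ?_
  · have h2 : d₁ * r + 2 * (d₂ / 2 * r) = (d₁ + d₂) * r := by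
      rw [← mul_assoc, Nat.mul_div_cancel' hd.two_dvd, add_mul]
    have h3 : unfolding h ^ r = ∑ α ∈ Finset.piAntidiag Finset.univ (d₁ * r),
        (∏ i, X i ^ α i) * coeff (Finsupp.equivFunOnFinite.symm α) (h ^ r) := by
      rw [unfolding, ← map_pow, eval_eq_sum_piAntidiag (hh.monomials.pow r)]
      exact Finset.sum_congr rfl fun α _ => mul_comm _ _
    rwa [h2, ← h3, ← pow_mul, mul_comm r 2] at h1
  · have h2 := inv_sq_diffScale_mul_pow_le hα
    have h3 : (Real.sqrt (d₁ * r : ℕ) ^ d₁) ^ r * (Real.sqrt (d₁ * r : ℕ) ^ d₁) ^ r =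
        ((d₁ * r : ℕ) : ℝ) ^ (d₁ * r) := by
      rw [← pow_mul, ← mul_pow, Real.mul_self_sqrt (Nat.cast_nonneg _)]
    have h5 : (4 : ℝ) ^ (d₁ * r) = 2 ^ (d₁ * r) * 2 ^ (d₁ * r) := by
      rw [← mul_pow]; norm_num
    have h6 : 0 ≤ (4 : ℝ) ^ (d₁ * r) * (c ^ r) ^ 2 := by positivity
    calc ((diffScale α)⁻¹ * (2 ^ (d₁ * r) * (Real.sqrt (d₁ * r : ℕ) ^ d₁ * c) ^ r)) ^ 2
        = (4 ^ (d₁ * r) * (c ^ r) ^ 2) *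
            ((diffScale α ^ 2)⁻¹ * ((d₁ * r : ℕ) : ℝ) ^ (d₁ * r)) := by
          rw [← h3, h5, mul_pow (_ ^ d₁) c r, ← inv_pow]; ring
      _ ≤ (4 ^ (d₁ * r) * (c ^ r) ^ 2) *
            ((Real.exp 1 ^ 2) ^ (d₁ * r) * (Nat.multinomial Finset.univ α : ℝ)) :=
          mul_le_mul_of_nonneg_left h2 h6
      _ = _ := by rw [mul_pow 4, ← pow_mul c, mul_comm r 2]; ring

theorem card_piAntidiag_univ_le {m q : ℕ} (hq : 0 < q) (hmq : m ≤ q) (hqn : q ≤ n) :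
    ((Finset.piAntidiag (Finset.univ : Finset (Fin n)) m).card : ℝ) ≤
      (2 * (n / q)) ^ m * Real.exp 1 ^ q := by
  have hcard : (Finset.piAntidiag (Finset.univ : Finset (Fin n)) m).card =
      (n + m - 1).choose m := by
    rw [← Finset.map_sym_eq_piAntidiag, Finset.card_map, Finset.sym_univ, Finset.card_univ,
      Sym.card_sym_eq_choose, Fintype.card_fin]
  have hq' : (0 : ℝ) < q := by exact_mod_cast hq
  have hf : (0 : ℝ) < m.factorial := by exact_mod_cast Nat.factorial_pos m
  -- Here `m ≤ q ≤ n` enters; next, `q^m / m! ≤ e^q` trades `n^m / m!` for `(n/q)^m`.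
  have h1 : ((n + m - 1 : ℕ) : ℝ) ≤ 2 * n := by
    exact_mod_cast (by omega : n + m - 1 ≤ 2 * n)
  calc ((Finset.piAntidiag (Finset.univ : Finset (Fin n)) m).card : ℝ)
      ≤ ((n + m - 1 : ℕ) : ℝ) ^ m / m.factorial := by
        rw [hcard]; exact Nat.choose_le_pow_div m _
    _ ≤ (2 * n) ^ m / m.factorial := by gcongr
    _ = (2 * (n / q)) ^ m * ((q : ℝ) ^ m / m.factorial) := by
        rw [← mul_div_assoc, ← mul_pow]
        congr 2
        field_simp
    _ ≤ (2 * (n / q)) ^ m * Real.exp 1 ^ q := by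
        gcongr
        rw [← Real.exp_nat_mul, mul_one]
        exact Real.pow_div_factorial_le_exp _ hq'.le m

theorem IsFolded.unfolding_isHomogeneous (hh : IsFolded d₁ d₂ h) :
    (unfolding h).IsHomogeneous (d₁ + d₂) := by
  rw [unfolding, eval_eq_sum_piAntidiag hh.monomials]
  refine IsHomogeneous.sum _ _ _ fun γ hγ => ?_
  rw [add_comm]
  refine (hh.folds _).mul ?_
  rw [← (Finset.mem_piAntidiag.1 hγ).1]
  exact IsHomogeneous.prod _ _ _ fun i _ => isHomogeneous_X_pow i _

theorem IsFolded.sosLambda_unfolding_pow_le (hh : IsFolded d₁ d₂ h) (hd : Even d₂) {S : ℝ}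
    (hS : foldedSup h ≤ S) {r : ℕ} (hr : 0 < r) (hpos : 0 < d₁ + d₂)
    (hn : 2 * (d₁ + d₂) * r ≤ n) :
    sosLambda (2 * (d₁ + d₂) * r) (unfolding h ^ (2 * r)) ≤
      ((8 * Real.exp 1 ^ 3) ^ (d₁ + d₂) * (foldGamma d₁ d₂ h * S) *
        ((n : ℝ) / (2 * (d₁ + d₂) * r : ℕ)) ^ ((d₁ : ℝ) / 2)) ^ (2 * r) := by
  have hq : 0 < 2 * (d₁ + d₂) * r := by positivity
  have hmq : d₁ * r ≤ 2 * (d₁ + d₂) * r := Nat.mul_le_mul_right r (by omega)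
  have : Nonempty (Fin n) := ⟨⟨0, by omega⟩⟩
  have hhalf : 2 * (d₁ + d₂) * r / 2 = (d₁ + d₂) * r := by
    rw [mul_assoc, Nat.mul_div_cancel_left _ two_pos]
  set N : ℝ := ((Finset.piAntidiag (Finset.univ : Finset (Fin n)) (d₁ * r)).card : ℝ)
  set q := 2 * (d₁ + d₂) * r with hqdef
  set T := foldGamma d₁ d₂ h * S
  have h1 : sosLambda q (unfolding h ^ (2 * r)) ≤
      N * ((4 * Real.exp 1 ^ 2) ^ (d₁ * r) * T ^ (2 * r)) := by
    -- Certificates exist only for `c > T`, as the infimum in `Λ` is approached strictly; the bound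
    -- at `T` is the limit as `c` decreases to `T`.
    have hcont : Filter.Tendsto (fun c : ℝ => N * ((4 * Real.exp 1 ^ 2) ^ (d₁ * r) * c ^ (2 * r)))
        (nhdsWithin T (Set.Ioi T))
        (nhds (N * ((4 * Real.exp 1 ^ 2) ^ (d₁ * r) * T ^ (2 * r)))) := by
      refine Filter.Tendsto.mono_left (Continuous.tendsto ?_ T) nhdsWithin_le_nhds
      fun_prop
    refine ge_of_tendsto hcont ?_
    filter_upwards [self_mem_nhdsWithin] with c hc
    refine sosLambda_le ?_
    rw [hhalf]
    exact hh.sub_unfolding_pow_mem_sosCone hd hS hc hr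
  have h2 : (((n : ℝ) / q) ^ ((d₁ : ℝ) / 2)) ^ (2 * r) = ((n : ℝ) / q) ^ (d₁ * r) := by
    rw [← Real.rpow_natCast, ← Real.rpow_natCast, ← Real.rpow_mul (by positivity)]
    congr 1
    push_cast
    ring
  have hT : 0 ≤ T ^ (2 * r) := by rw [pow_mul]; positivity
  have h3 : (4 * Real.exp 1 ^ 2) ^ (d₁ * r) * 2 ^ (d₁ * r) * Real.exp 1 ^ q ≤
      ((8 * Real.exp 1 ^ 3) ^ (d₁ + d₂)) ^ (2 * r) := by
    have he : 1 ≤ Real.exp 1 := Real.one_le_exp zero_le_one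
    have h8 : (1 : ℝ) ≤ 8 * Real.exp 1 ^ 2 := by nlinarith
    calc (4 * Real.exp 1 ^ 2) ^ (d₁ * r) * 2 ^ (d₁ * r) * Real.exp 1 ^ q
        = (8 * Real.exp 1 ^ 2) ^ (d₁ * r) * Real.exp 1 ^ q := by
          rw [← mul_pow]; ring_nf
      _ ≤ (8 * Real.exp 1 ^ 2) ^ q * Real.exp 1 ^ q := by gcongr
      _ = ((8 * Real.exp 1 ^ 3) ^ (d₁ + d₂)) ^ (2 * r) := by
          rw [← mul_pow, ← pow_mul, hqdef]
          congr 1 <;> ring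
  calc sosLambda q (unfolding h ^ (2 * r))
      ≤ N * ((4 * Real.exp 1 ^ 2) ^ (d₁ * r) * T ^ (2 * r)) := h1
    _ ≤ ((2 * ((n : ℝ) / q)) ^ (d₁ * r) * Real.exp 1 ^ q) *
          ((4 * Real.exp 1 ^ 2) ^ (d₁ * r) * T ^ (2 * r)) := by
        gcongr
        exact card_piAntidiag_univ_le hq hmq hn
    _ = ((4 * Real.exp 1 ^ 2) ^ (d₁ * r) * 2 ^ (d₁ * r) * Real.exp 1 ^ q) *
          (T ^ (2 * r) * ((n : ℝ) / q) ^ (d₁ * r)) := by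
        rw [mul_pow 2]; ring
    _ ≤ ((8 * Real.exp 1 ^ 3) ^ (d₁ + d₂)) ^ (2 * r) *
          (T ^ (2 * r) * ((n : ℝ) / q) ^ (d₁ * r)) := by
        gcongr
    _ = _ := by rw [← h2, ← mul_pow, ← mul_pow, mul_assoc (_ ^ _) T]

/-- `Λ` dominates the value of an even power at a unit vector. Nonnegativity is needed to take the
real `2r`-th root monotonically. -/
theorem IsFolded.sosLambda_unfolding_pow_nonneg [Nonempty (Fin n)] (hh : IsFolded d₁ d₂ h)
    (r : ℕ) : 0 ≤ sosLambda (2 * (d₁ + d₂) * r) (unfolding h ^ (2 * r)) := by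
  obtain ⟨x, hx⟩ := exists_sum_sq_eq_one (ι := Fin n)
  obtain ⟨c₀, -, hc₀⟩ := exists_sosBounded n (2 * (d₁ + d₂) * r / 2)
  have hhom := hh.unfolding_isHomogeneous.pow (2 * r)
  have hdeg : (d₁ + d₂) * (2 * r) = 2 * (2 * (d₁ + d₂) * r / 2) := by
    rw [mul_assoc 2, Nat.mul_div_cancel_left _ two_pos]; ring
  rw [hdeg] at hhom
  refine le_trans ?_ (eval_le_sosLambda (hc₀ _ hhom) hx)
  rw [map_pow, pow_mul]
  positivity

end PowerOfFolded

theorem mainTheorem9 :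
    ∃ A : ℝ, 0 < A ∧
      ∀ (d₁ d₂ n q : ℕ) (K : ℝ) (h : MvPolynomial (Fin n) (MvPolynomial (Fin n) ℝ)),
        Even d₂ →
        IsFolded d₁ d₂ h →
        foldedSup h ≤ K * sphereNorm (unfolding h) →
        0 < q →
        q ≤ n →
        2 * (d₁ + d₂) ∣ q →
        sosLambda q (unfolding h ^ (q / (d₁ + d₂))) ^ (((d₁ + d₂ : ℕ) : ℝ) / (q : ℝ)) ≤
          A ^ (d₁ + d₂) * K *
            (foldGamma d₁ d₂ h * ((n : ℝ) / (q : ℝ)) ^ ((d₁ : ℝ) / 2)) *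
            sphereNorm (unfolding h) := by
  -- `8 = 4 · 2`: `4` is the squared total weight `2^m` of the difference, per degree, and `2` comes
  -- from `n + m - 1 ≤ 2n`. Of `e³`, `e²` comes from the scale of the difference and `e` from the
  -- count of exponents.
  refine ⟨8 * Real.exp 1 ^ 3, by positivity, ?_⟩
  rintro d₁ d₂ n _ K h hd hh hK hq hqn ⟨r, rfl⟩
  have hr : 0 < r := Nat.pos_of_mul_pos_left hq
  have hpos : 0 < d₁ + d₂ := by
    rcases Nat.eq_zero_or_pos (d₁ + d₂) with h0 | h0
    · simp [h0] at hq
    · exact h0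
  have : Nonempty (Fin n) := ⟨⟨0, by omega⟩⟩
  have hk : 2 * (d₁ + d₂) * r / (d₁ + d₂) = 2 * r :=
    Nat.div_eq_of_eq_mul_left hpos (by ring)
  have hexp : ((d₁ + d₂ : ℕ) : ℝ) / ((2 * (d₁ + d₂) * r : ℕ) : ℝ) = ((2 * r : ℕ) : ℝ)⁻¹ := by
    have h1 : ((d₁ + d₂ : ℕ) : ℝ) ≠ 0 := by exact_mod_cast hpos.ne'
    have h2 : (r : ℝ) ≠ 0 := by exact_mod_cast hr.ne'
    rw [Nat.cast_mul, Nat.cast_mul, Nat.cast_mul]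
    field_simp
  have hΓ := hh.foldGamma_nonneg hd
  have hS : 0 ≤ K * sphereNorm (unfolding h) := (foldedSup_nonneg h).trans hK
  rw [hk, hexp]
  refine (Real.rpow_le_rpow (hh.sosLambda_unfolding_pow_nonneg r)
    (hh.sosLambda_unfolding_pow_le hd hK hr hpos hqn) (by positivity)).trans_eq ?_
  rw [Real.pow_rpow_inv_natCast (by positivity) (by positivity)]
  ring
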